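/- Let $n\ge 1$ and let $A\in\mathbb{R}^{n\times n}$. For $1\le k\le n$ let $[A]_{k,k}$ denote the $k$-th leading principal submatrix of $A$, formed by rows $1,\dots,k$ and columns $1,\dots,k$. A real square matrix is called a Hurwitz matrix if all of its complex eigenvalues have strictly negative real part. If every leading principal submatrix $[A]_{k,k}$, $1\le k\le n$, has full rank $k$, then there exist real numbers $c_1,\dots,c_n$ such that, with $C=\operatorname{diag}(c_1,\dots,c_n)$, the matrix $CA$ is a Hurwitz matrix. -/

import Mathlib

/-- The `k`-th leading principal submatrix `[A]ₖₖ` of an `n × n` matrix `A`, for `k ≤ n`: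
the entries in the first `k` rows and the first `k` columns. -/
def Matrix.leadingPrincipal {n : ℕ} (A : Matrix (Fin n) (Fin n) ℝ) (k : ℕ) (hk : k ≤ n) :
    Matrix (Fin k) (Fin k) ℝ :=
  A.submatrix (Fin.castLE hk) (Fin.castLE hk)

/-- A real square matrix is Hurwitz if all of its complex eigenvalues have
strictly negative real part. -/
def Matrix.IsHurwitz {n : ℕ} (M : Matrix (Fin n) (Fin n) ℝ) : Prop :=
  ∀ μ : ℂ, Module.End.HasEigenvalue (Matrix.toLin' (M.map Complex.ofReal)) μ → μ.re < 0

/-!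
The diagonal entries are chosen one at a time, by bordering. Suppose `M = C'A'` is already stable,
where `A'` is the leading principal submatrix of `A` of size `n`, and write the next one as
`A = [[A', b], [r, a]]`. Let `A' w = b`; then `s = a - r ⬝ w` is the Schur complement of `A'`, and it
is nonzero because `A` is invertible. If the last diagonal entry is a small real number `ε` with
`ε s < 0`, then the spectrum of the bordered matrix consists of a perturbation of the spectrum of
`M` and one more eigenvalue close to `ε s`, so it stays in the open left half-plane.

To make this precise without perturbation theory, the induction carries the uniform bound
`‖x‖ ≤ K ‖M x - μ x‖` for the resolvent on the closed right half-plane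
(`Matrix.HasResolventBound`), which excludes eigenvalues there. If `(x, y)` is sent by the bordered
matrix minus `μ` to `(f, g)`, then `z = x + y w` satisfies
`(M - μ) z = f - μ y w` and `(μ - ε s) y = ε (r ⬝ z) - g`.
The bound for `M` controls `z` by `‖f‖` and `‖μ‖ ‖y‖`, and `‖μ - ε s‖` dominates both `‖μ‖` and
`‖ε s‖` since `Re μ ≥ 0 > ε s`; for small `ε` the term in `‖μ‖ ‖y‖` is absorbed, and the bound for
the bordered matrix follows (`Matrix.HasResolventBound.border`).
-/

open Matrix

/-- The resolvent of `M` is bounded, uniformly on the closed right half-plane `0 ≤ Re μ`. It is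
expressed as a lower bound for `M - μ` on complex vectors, which carry the supremum norm. -/
def Matrix.HasResolventBound {n : ℕ} (M : Matrix (Fin n) (Fin n) ℝ) : Prop :=
  ∃ K : ℝ, 0 ≤ K ∧ ∀ μ : ℂ, 0 ≤ μ.re → ∀ x : Fin n → ℂ,
    ‖x‖ ≤ K * ‖M.map Complex.ofReal *ᵥ x - μ • x‖

theorem Matrix.HasResolventBound.isHurwitz {n : ℕ} {M : Matrix (Fin n) (Fin n) ℝ}
    (h : M.HasResolventBound) : M.IsHurwitz := by
  obtain ⟨K, -, hK⟩ := h
  intro μ hμ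
  by_contra! hre
  obtain ⟨x, hx⟩ := hμ.exists_hasEigenvector
  have hx' := hx.apply_eq_smul
  rw [Matrix.toLin'_apply] at hx'
  have := hK μ hre x
  rw [hx', sub_self, norm_zero, mul_zero] at this
  exact hx.2 (norm_le_zero_iff.1 this)

theorem norm_dotProduct_le_sum_norm_mul {n : ℕ} (r z : Fin n → ℂ) :
    ‖r ⬝ᵥ z‖ ≤ (∑ i, ‖r i‖) * ‖z‖ := by
  rw [dotProduct, Finset.sum_mul]
  refine (norm_sum_le _ _).trans (Finset.sum_le_sum fun i _ => ?_)
  rw [norm_mul]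
  exact mul_le_mul_of_nonneg_left (norm_le_pi_norm z i) (norm_nonneg _)

theorem Complex.norm_le_norm_sub_ofReal {μ : ℂ} (hμ : 0 ≤ μ.re) {t : ℝ} (ht : t ≤ 0) :
    ‖μ‖ ≤ ‖μ - t‖ ∧ |t| ≤ ‖μ - t‖ := by
  constructor
  · rw [Complex.norm_def, Complex.norm_def]
    apply Real.sqrt_le_sqrt
    simp only [Complex.normSq_apply, Complex.sub_re, Complex.sub_im, Complex.ofReal_re,
      Complex.ofReal_im]
    nlinarith [mul_nonneg hμ (neg_nonneg.2 ht)]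
  · refine le_trans ?_ (Complex.abs_re_le_norm _)
    rw [Complex.sub_re, Complex.ofReal_re, abs_of_nonpos ht, abs_of_nonneg (by linarith)]
    linarith

/-- Let `f` and `g` be the components of the bordered matrix `[[M, b], [ε r, ε a]]` minus `μ`,
applied to `(x, y)`, where `M w = b` and `t = ε (a - r ⬝ w)`. If `ε` is small and `t < 0`, then the
bound `K` for the resolvent of `M` gives a bound for `y` that does not depend on `μ`. -/
theorem norm_le_of_resolvent_bound_border {n : ℕ} {M : Matrix (Fin n) (Fin n) ℂ} {K : ℝ}
    {μ : ℂ} (hμ : 0 ≤ μ.re) (hK0 : 0 ≤ K)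
    (hK : ∀ x : Fin n → ℂ, ‖x‖ ≤ K * ‖M *ᵥ x - μ • x‖)
    {w b r : Fin n → ℂ} (hw : M *ᵥ w = b) {ε t : ℝ} {a : ℂ} (hs : (t : ℂ) = ε * (a - r ⬝ᵥ w))
    (ht : t < 0) (hε : |ε| * (∑ i, ‖r i‖) * K * ‖w‖ ≤ 1 / 2) (x : Fin n → ℂ) (y : ℂ) {D : ℝ}
    (hf : ‖M *ᵥ x + y • b - μ • x‖ ≤ D) (hg : ‖ε * (r ⬝ᵥ x + a * y) - μ * y‖ ≤ D) :
    ‖y‖ ≤ 2 * (1 + |ε| * (∑ i, ‖r i‖) * K) / |t| * D := by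
  set R := ∑ i, ‖r i‖ with hR
  have hR0 : 0 ≤ R := Finset.sum_nonneg fun i _ => norm_nonneg _
  have hz : ‖x + y • w‖ ≤ K * (D + ‖μ‖ * ‖y‖ * ‖w‖) := by
    refine (hK _).trans (mul_le_mul_of_nonneg_left ?_ hK0)
    have h : M *ᵥ (x + y • w) - μ • (x + y • w)
        = (M *ᵥ x + y • b - μ • x) - (μ * y) • w := by
      rw [mulVec_add, mulVec_smul, hw, smul_add, smul_smul]
      abel
    rw [h]
    refine (norm_sub_le _ _).trans (add_le_add hf ?_)
    rw [norm_smul, norm_mul]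
  have hy : ‖μ - t‖ * ‖y‖ ≤ D + |ε| * (R * (K * (D + ‖μ‖ * ‖y‖ * ‖w‖))) := by
    have h : (μ - t) * y = ε * (r ⬝ᵥ (x + y • w)) - (ε * (r ⬝ᵥ x + a * y) - μ * y) := by
      rw [hs, dotProduct_add, dotProduct_smul, smul_eq_mul]
      ring
    rw [← norm_mul, h]
    refine (norm_sub_le _ _).trans ?_
    rw [add_comm, norm_mul, Complex.norm_real, Real.norm_eq_abs]
    refine add_le_add hg (mul_le_mul_of_nonneg_left ?_ (abs_nonneg _))
    exact (norm_dotProduct_le_sum_norm_mul _ _).trans (mul_le_mul_of_nonneg_left hz hR0)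
  obtain ⟨h1, h2⟩ := Complex.norm_le_norm_sub_ofReal hμ ht.le
  have ht0 : 0 < |t| := abs_pos.2 ht.ne
  -- The part of the right-hand side that contains `y` is at most half of the left-hand side.
  have h3 : |ε| * R * K * ‖w‖ * (‖μ‖ * ‖y‖) ≤ 1 / 2 * (‖μ - t‖ * ‖y‖) := by gcongr
  have h4 : |t| * ‖y‖ ≤ ‖μ - t‖ * ‖y‖ := by gcongr
  rw [div_mul_eq_mul_div, le_div_iff₀ ht0]
  linarith

/-- The bordering step: `A` extends an invertible `A'` (with `A' w` the new column) by a row and a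
column so that the Schur complement of `A'` does not vanish. -/
theorem Matrix.HasResolventBound.border {n : ℕ} {A : Matrix (Fin (n + 1)) (Fin (n + 1)) ℝ}
    {c : Fin n → ℝ}
    (h : (diagonal c * A.submatrix Fin.castSucc Fin.castSucc).HasResolventBound)
    {w : Fin n → ℝ}
    (hw : A.submatrix Fin.castSucc Fin.castSucc *ᵥ w = fun i => A i.castSucc (Fin.last n))
    (hs : A (Fin.last n) (Fin.last n) - ∑ j, A (Fin.last n) (Fin.castSucc j) * w j ≠ 0) :
    ∃ ε : ℝ, (diagonal (Fin.snoc c ε : Fin (n + 1) → ℝ) * A).HasResolventBound := by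
  obtain ⟨K, hK0, hK⟩ := h
  set M := diagonal c * A.submatrix Fin.castSucc Fin.castSucc with hM
  set s := A (Fin.last n) (Fin.last n) - ∑ j, A (Fin.last n) (Fin.castSucc j) * w j with hsdef
  let r : Fin n → ℂ := fun j => (A (Fin.last n) j.castSucc : ℂ)
  let b : Fin n → ℂ := fun i => ((c i * A i.castSucc (Fin.last n) : ℝ) : ℂ)
  let w' : Fin n → ℂ := fun j => (w j : ℂ)
  set R := ∑ i, ‖r i‖ with hR
  have hR0 : 0 ≤ R := Finset.sum_nonneg fun i _ => norm_nonneg _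
  have hMw : M.map Complex.ofReal *ᵥ w' = b := by
    have h : M *ᵥ w = fun i => c i * A i.castSucc (Fin.last n) := by
      rw [hM, ← mulVec_mulVec, hw]
      ext i
      rw [mulVec_diagonal]
    ext i
    have hi := congrArg Complex.ofReal (congrFun h i)
    simpa [mulVec, dotProduct, b, w'] using hi
  have hq : 0 ≤ R * K * ‖w'‖ := by positivity
  have hs0 : 0 < |s| := abs_pos.2 hs
  -- The sign of `ε` is opposite to that of `s`, and its size is `1 / (2 (R K ‖w‖ + 1))`.
  set ε : ℝ := -s / (|s| * (2 * (R * K * ‖w'‖ + 1))) with hεdef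
  have hεabs : |ε| = 1 / (2 * (R * K * ‖w'‖ + 1)) := by
    rw [hεdef, abs_div, abs_neg, abs_of_pos (by positivity : 0 < |s| * (2 * (R * K * ‖w'‖ + 1)))]
    field_simp
  have hε : |ε| * R * K * ‖w'‖ ≤ 1 / 2 := by
    have : |ε| * R * K * ‖w'‖ = |ε| * (R * K * ‖w'‖) := by ring
    rw [this, hεabs, div_mul_eq_mul_div, div_le_iff₀ (by positivity)]
    linarith
  have ht : ε * s < 0 := by
    have : ε * s = -(s ^ 2 / (|s| * (2 * (R * K * ‖w'‖ + 1)))) := by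
      rw [hεdef]; ring
    rw [this, neg_lt_zero]
    positivity
  refine ⟨ε, ?_⟩
  set K₁ := 2 * (1 + |ε| * R * K) / |ε * s| with hK₁
  have hK₁0 : 0 ≤ K₁ := by positivity
  refine ⟨K * (1 + K₁ * ‖b‖) + K₁, by positivity, fun μ hμ v => ?_⟩
  set F := (diagonal (Fin.snoc c ε : Fin (n + 1) → ℝ) * A).map Complex.ofReal *ᵥ v - μ • v with hF
  let x : Fin n → ℂ := fun i => v i.castSucc
  let y : ℂ := v (Fin.last n)
  have hFx : (M.map Complex.ofReal *ᵥ x + y • b - μ • x) = fun i => F i.castSucc := by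
    ext i
    simp only [hF, hM, mulVec, dotProduct, Pi.sub_apply, Pi.add_apply, Pi.smul_apply, smul_eq_mul,
      Fin.sum_univ_castSucc, map_apply, diagonal_mul, Fin.snoc_castSucc, submatrix_apply, b, x, y]
    ring
  have hFy : ε * (r ⬝ᵥ x + A (Fin.last n) (Fin.last n) * y) - μ * y = F (Fin.last n) := by
    simp only [hF, mulVec, dotProduct, Pi.sub_apply, Pi.smul_apply, smul_eq_mul,
      Fin.sum_univ_castSucc, map_apply, diagonal_mul, Fin.snoc_last, mul_add, Finset.mul_sum,
      Complex.ofReal_mul, mul_assoc, r, x, y]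
  have hf : ‖M.map Complex.ofReal *ᵥ x + y • b - μ • x‖ ≤ ‖F‖ := by
    rw [hFx, pi_norm_le_iff_of_nonneg (norm_nonneg _)]
    exact fun i => norm_le_pi_norm F _
  have hy : ‖y‖ ≤ K₁ * ‖F‖ := by
    refine norm_le_of_resolvent_bound_border hμ hK0 (hK μ hμ) hMw (a := A (Fin.last n) (Fin.last n))
      ?_ ht hε x y hf (by rw [hFy]; exact norm_le_pi_norm F _)
    simp [hsdef, dotProduct, r, w']
  have hx : ‖x‖ ≤ K * (1 + K₁ * ‖b‖) * ‖F‖ := by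
    rw [mul_assoc]
    refine (hK μ hμ x).trans (mul_le_mul_of_nonneg_left ?_ hK0)
    have h : M.map Complex.ofReal *ᵥ x - μ • x
        = (M.map Complex.ofReal *ᵥ x + y • b - μ • x) - y • b := by abel
    rw [h]
    refine (norm_sub_le _ _).trans ?_
    rw [norm_smul]
    have := mul_le_mul_of_nonneg_right hy (norm_nonneg b)
    linarith
  rw [pi_norm_le_iff_of_nonneg (by positivity), add_mul]
  refine Fin.lastCases ?_ fun i => ?_
  · exact hy.trans (le_add_of_nonneg_left (by positivity))
  · exact (norm_le_pi_norm x i).trans (hx.trans (le_add_of_nonneg_right (by positivity)))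

/-- A nonzero vector `(w, -1)` in the kernel is what a vanishing Schur complement amounts to. -/
theorem Matrix.schur_ne_zero_of_isUnit {n : ℕ} {A : Matrix (Fin (n + 1)) (Fin (n + 1)) ℝ}
    (hA : IsUnit A) {w : Fin n → ℝ}
    (hw : A.submatrix Fin.castSucc Fin.castSucc *ᵥ w = fun i => A i.castSucc (Fin.last n)) :
    A (Fin.last n) (Fin.last n) - ∑ j, A (Fin.last n) (Fin.castSucc j) * w j ≠ 0 := by
  intro hs
  have h0 : A *ᵥ (Fin.snoc w (-1) : Fin (n + 1) → ℝ) = A *ᵥ 0 := by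
    rw [mulVec_zero]
    ext i
    refine Fin.lastCases ?_ (fun i => ?_) i
    · simp only [mulVec, dotProduct, Fin.sum_univ_castSucc, Fin.snoc_castSucc, Fin.snoc_last,
        Pi.zero_apply]
      linarith
    · have := congrFun hw i
      simp only [mulVec, dotProduct, submatrix_apply] at this
      simp only [mulVec, dotProduct, Fin.sum_univ_castSucc, Fin.snoc_castSucc, Fin.snoc_last,
        Pi.zero_apply, this]
      ring
  have := congrFun (mulVec_injective_of_isUnit hA h0) (Fin.last n)
  simp at this

theorem Matrix.exists_diagonal_mul_hasResolventBound {n : ℕ} (A : Matrix (Fin n) (Fin n) ℝ)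
    (hA : ∀ (k : ℕ) (hk : k ≤ n), IsUnit (A.leadingPrincipal k hk)) :
    ∃ c : Fin n → ℝ, (diagonal c * A).HasResolventBound := by
  induction n with
  | zero =>
    refine ⟨0, 0, le_rfl, fun μ _ x => ?_⟩
    rw [Subsingleton.elim x 0, norm_zero, zero_mul]
  | succ n ih =>
    have hA' := hA n n.le_succ
    obtain ⟨c, hc⟩ := ih (A.submatrix Fin.castSucc Fin.castSucc)
      fun k hk => hA k (hk.trans n.le_succ)
    obtain ⟨w, hw⟩ := mulVec_surjective_iff_isUnit.2 hA' fun i => A i.castSucc (Fin.last n)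
    obtain ⟨ε, hε⟩ := hc.border hw (schur_ne_zero_of_isUnit (hA (n + 1) le_rfl) hw)
    exact ⟨_, hε⟩

theorem mainTheorem2 (n : ℕ) (A : Matrix (Fin n) (Fin n) ℝ)
    (hA : ∀ (k : ℕ) (hk : k ≤ n), 1 ≤ k → (A.leadingPrincipal k hk).rank = k) :
    ∃ c : Fin n → ℝ, (Matrix.diagonal c * A).IsHurwitz := by
  obtain ⟨c, hc⟩ := A.exists_diagonal_mul_hasResolventBound fun k hk => by
    rcases Nat.eq_zero_or_pos k with rfl | hk0
    · exact isUnit_of_subsingleton _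
    · rw [← mulVec_surjective_iff_isUnit]
      have h := hA k hk hk0
      rw [Matrix.rank] at h
      have : LinearMap.range (A.leadingPrincipal k hk).mulVecLin = ⊤ :=
        Submodule.eq_top_of_finrank_eq (by simpa using h)
      exact LinearMap.range_eq_top.1 this
  exact ⟨c, hc.isHurwitz⟩
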